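/- Let $G$ be a finite group with $k$ conjugacy classes $C_1,\dots,C_k$ and irreducible complex representations $V_1,\dots,V_k$, all of whose irreducible complex characters take only integer values, let $p$ be a prime and $N\ge 0$ an integer. A $k$-multipartition of $N$ is a tuple $\lambda=(\lambda_1,\dots,\lambda_k)$ of partitions with $\sum_i|\lambda_i|=N$. Let $G\wr S_N$ be the group of $N\times N$ monomial matrices with nonzero entries in $G$. Its conjugacy classes are labelled by $k$-multipartitions $\mu$ of $N$: an element belongs to the class of $\mu$ if, for each $i$, the parts of $\mu_i$ are the lengths of those of its cycles for which the product of the nonzero entries along the cycle lies in $C_i$. For a $k$-multipartition $\lambda$ of $N$ put $a_i=|\lambda_i|$ and $G_{\lambda_i}=G\wr S_{\lambda_i}$, where $S_{\lambda_i}\subseteq S_{a_i}$ is the Young subgroup of $\lambda_i$, and let $$M^\lambda=\mathrm{Ind}_{G_{\lambda_1}\times\cdots\times G_{\lambda_k}}^{G\wr S_N}\Big(\boxtimes_{i=1}^k V_i^{\otimes a_i}\Big),$$ where $G^{a_i}$ acts factorwise on $V_i^{\otimes a_i}$ and $S_{\lambda_i}$ permutes the tensor factors. Let $M^\lambda_\mu$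 denote the value of the character of $M^\lambda$ on the conjugacy class labelled by $\mu$. Let $\sim_p$ be the equivalence relation on $k$-multipartitions of $N$ generated by $\mu\sim_p\nu$ whenever, for some $j$ and some $m\ge 1$, $\mu_i=\nu_i$ for all $i\ne j$ and $\nu_j$ is obtained from $\mu_j$ by replacing one part of size $mp$ by $p$ parts of size $m$. If $\mu$ and $\nu$ are $k$-multipartitions of $N$ with $\mu\sim_p\nu$, then for every $k$-multipartition $\lambda$ of $N$ the values $M^\lambda_\mu$ and $M^\lambda_\nu$ are integers and $$M^\lambda_\mu\equiv M^\lambda_\nu\pmod p .$$ -/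

import Mathlib

open scoped TensorProduct

noncomputable section

/-! ### Multipartitions -/

/-- A `k`-multipartition of `N`: a `k`-tuple of partitions (finite multisets of positive
integers) of total size `N`. -/
@[ext]
structure Multipartition (k N : ℕ) where
  parts : Fin k → Multiset ℕ
  parts_pos : ∀ i, ∀ a ∈ parts i, 0 < a
  sum_parts : ∑ i, (parts i).sum = N

namespace Multipartition

variable {k N : ℕ}

/-- `Mash p μ ν`: the multipartition `ν` arises from `μ` by replacing, in one component `j`,
one part of size `m * p` by `p` parts of size `m`. -/
def Mash (p : ℕ) (μ ν : Multipartition k N) : Prop :=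
  ∃ (j : Fin k) (m : ℕ) (ξ : Multiset ℕ), (∀ i, i ≠ j → μ.parts i = ν.parts i) ∧
    μ.parts j = (m * p) ::ₘ ξ ∧ ν.parts j = Multiset.replicate p m + ξ

/-- The equivalence relation `∼_p` on `k`-multipartitions of `N`. -/
def MashEquiv (p : ℕ) : Multipartition k N → Multipartition k N → Prop :=
  Relation.EqvGen (Mash p)

/-- The rows of a multipartition, each row being recorded as the pair (component, length);
first the rows of the first component in decreasing order of length, then those of the second
component, and so on. -/
def rows (lam : Multipartition k N) : List (Fin k × ℕ) :=
  (List.finRange k).flatMap fun i => ((lam.parts i).sort (· ≥ ·)).map fun a => (i, a)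

theorem rows_pos (lam : Multipartition k N) {a : ℕ} (ha : a ∈ lam.rows.map Prod.snd) :
    0 < a := by
  simp only [rows, List.mem_map, List.mem_flatMap] at ha
  obtain ⟨r, ⟨i, -, b, hb, rfl⟩, rfl⟩ := ha
  exact lam.parts_pos i b (by simpa using hb)

theorem rows_sum (lam : Multipartition k N) : (lam.rows.map Prod.snd).sum = N := by
  refine Eq.trans ?_ lam.sum_parts
  rw [rows, List.map_flatMap, List.flatMap, List.sum_flatten, List.map_map,
    ← List.ofFn_eq_map, List.sum_ofFn]
  refine Finset.sum_congr rfl fun i _ => ?_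
  simp only [Function.comp_apply, List.map_map]
  have h : (Prod.snd ∘ fun a : ℕ => (i, a)) = id := rfl
  rw [h, List.map_id, ← Multiset.sum_coe, Multiset.sort_eq]

/-- The cutting of `{0, …, N - 1}` into consecutive blocks, one for each row of `lam`. -/
def rowBlocks (lam : Multipartition k N) : Composition N where
  blocks := lam.rows.map Prod.snd
  blocks_pos := lam.rows_pos
  blocks_sum := lam.rows_sum

/-- The (index of the) row of `lam` to which the position `x` belongs. -/
def rowOf (lam : Multipartition k N) (x : Fin N) : Fin lam.rows.length :=
  Fin.cast (by simp [rowBlocks, Composition.length]) (lam.rowBlocks.index x)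

/-- The component of `lam` to which the position `x` belongs. -/
def componentOf (lam : Multipartition k N) (x : Fin N) : Fin k :=
  (lam.rows.get (lam.rowOf x)).1

end Multipartition

/-! ### Wreath products and cycle products -/

/-- The wreath product `G ≀ S_ι`, i.e. the semidirect product `G^ι ⋊ S_ι`. The pair `(f, σ)`
corresponds to the `ι × ι` monomial matrix whose entry in row `σ x` and column `x` is `f (σ x)`,
the other entries being zero. -/
abbrev WreathProduct (G : Type*) [Group G] (ι : Type*) : Type _ :=
  SemidirectProduct (ι → G) (Equiv.Perm ι) mulAutArrow

namespace WreathProduct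

variable {G : Type*} [Group G]

/-- The length of the cycle of `w` through `x`. -/
def cycleLength {ι : Type*} (w : WreathProduct G ι) (x : ι) : ℕ :=
  Function.minimalPeriod w.right x

/-- The product `f (x) f (σ⁻¹ x) f (σ⁻² x) ⋯` of the nonzero entries of `w = (f, σ)` along the
cycle through `x`. -/
def cycleProduct {ι : Type*} (w : WreathProduct G ι) (x : ι) : G :=
  ((List.range (w.cycleLength x)).map fun m => w.left ((w.right⁻¹ ^ m) x)).prod

/-- The conjugacy class in `G` of the cycle product of `w` along the cycle through `x`. -/
def cycleClass {ι : Type*} (w : WreathProduct G ι) (x : ι) : ConjClasses G :=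
  ConjClasses.mk (w.cycleProduct x)

variable {N : ℕ}

theorem right_pow_cycleLength {ι : Type*} (w : WreathProduct G ι) (x : ι) :
    (w.right ^ w.cycleLength x) x = x := by
  have := Function.iterate_minimalPeriod (f := w.right) (x := x)
  rwa [Equiv.Perm.iterate_eq_pow] at this

theorem cycleLength_apply (w : WreathProduct G (Fin N)) (x : Fin N) :
    w.cycleLength (w.right x) = w.cycleLength x :=
  Function.minimalPeriod_apply (Function.Injective.mem_periodicPts w.right.injective x)

theorem cycleClass_apply (w : WreathProduct G (Fin N)) (x : Fin N) :
    w.cycleClass (w.right x) = w.cycleClass x := by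
  have key : w.left (w.right x) * w.cycleProduct x
      = w.cycleProduct (w.right x) * w.left (w.right x) := by
    have hx : (w.right⁻¹ ^ w.cycleLength x) (w.right x) = w.right x := by
      rw [inv_pow, Equiv.Perm.inv_eq_iff_eq, ← Equiv.Perm.mul_apply, ← pow_succ, pow_succ',
        Equiv.Perm.mul_apply, right_pow_cycleLength]
    have hxx : w.right⁻¹ (w.right x) = x := w.right.symm_apply_apply x
    have h1 := List.prod_range_succ (fun m => w.left ((w.right⁻¹ ^ m) (w.right x)))
      (w.cycleLength x)
    have h2 := List.prod_range_succ' (fun m => w.left ((w.right⁻¹ ^ m) (w.right x)))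
      (w.cycleLength x)
    rw [h1, hx] at h2
    simp only [pow_succ, Equiv.Perm.mul_apply, pow_zero,
      Equiv.Perm.one_apply, hxx] at h2
    rw [cycleProduct, cycleProduct, cycleLength_apply]
    exact h2.symm
  refine (ConjClasses.mk_eq_mk_iff_isConj.2 (isConj_iff.2 ⟨w.left (w.right x), ?_⟩)).symm
  rw [key, mul_inv_cancel_right]

theorem apply_eq_of_sameCycle {α : Type*} (σ : Equiv.Perm (Fin N)) (F : Fin N → α)
    (hF : ∀ x, F (σ x) = F x) {x y : Fin N} (h : σ.SameCycle x y) : F x = F y := by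
  obtain ⟨n, rfl⟩ := h.exists_nat_pow_eq
  induction n with
  | zero => rfl
  | succ n ih =>
    rw [pow_succ', Equiv.Perm.mul_apply, hF]
    exact ih ⟨n, by simp⟩

/-- The set of cycles of `w` (fixed points included). -/
abbrev Cycles (w : WreathProduct G (Fin N)) : Type :=
  Quotient (Equiv.Perm.SameCycle.setoid w.right)

open Classical in
instance (w : WreathProduct G (Fin N)) : Fintype w.Cycles :=
  Quotient.fintype _

/-- The length of a cycle. -/
def Cycles.length {w : WreathProduct G (Fin N)} (q : w.Cycles) : ℕ :=
  Quotient.lift w.cycleLength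
    (fun _ _ h => apply_eq_of_sameCycle w.right _ w.cycleLength_apply h) q

/-- The conjugacy class in `G` attached to a cycle. -/
def Cycles.conjClass {w : WreathProduct G (Fin N)} (q : w.Cycles) : ConjClasses G :=
  Quotient.lift w.cycleClass
    (fun _ _ h => apply_eq_of_sameCycle w.right _ w.cycleClass_apply h) q

theorem Cycles.length_pos {w : WreathProduct G (Fin N)} (q : w.Cycles) : 0 < q.length := by
  induction q using Quotient.inductionOn with
  | h x =>
    exact Function.minimalPeriod_pos_of_mem_periodicPts
      (Function.Injective.mem_periodicPts w.right.injective x)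

open Classical in
theorem Cycles.card_fiber {w : WreathProduct G (Fin N)} (q : w.Cycles) :
    (Finset.univ.filter fun x : Fin N => (Quotient.mk _ x : w.Cycles) = q).card = q.length := by
  induction q using Quotient.inductionOn with
  | h x =>
    change _ = Function.minimalPeriod w.right x
    have h := MulAction.minimalPeriod_eq_card (a := w.right) (b := x)
    change Function.minimalPeriod w.right x = _ at h
    rw [h, ← Set.toFinset_card]
    congr 1
    ext y
    simp only [Finset.mem_filter, Finset.mem_univ, true_and, Set.mem_toFinset, Quotient.eq]
    rw [MulAction.mem_orbit_iff]
    constructor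
    · intro hy
      obtain ⟨n, hn⟩ := (show w.right.SameCycle y x from hy).symm
      exact ⟨⟨w.right ^ n, n, rfl⟩, hn⟩
    · rintro ⟨⟨_, n, rfl⟩, hn⟩
      exact (show w.right.SameCycle x y from ⟨n, hn⟩).symm

open Classical in
/-- The multipartition of `w ∈ G ≀ S_N`, with respect to a numbering `c` of the conjugacy classes
of `G`: each cycle of `w` whose cycle product lies in the `i`-th conjugacy class contributes its
length as a part of the `i`-th component. -/
def cycleType {k : ℕ} (c : Fin k ≃ ConjClasses G) (w : WreathProduct G (Fin N)) :
    Multipartition k N where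
  parts i := (Finset.univ.filter fun q : w.Cycles => q.conjClass = c i).val.map Cycles.length
  parts_pos i a ha := by
    obtain ⟨q, -, rfl⟩ := Multiset.mem_map.1 ha
    exact q.length_pos
  sum_parts := by
    have h1 : ∀ i, ((Finset.univ.filter fun q : w.Cycles => q.conjClass = c i).val.map
        Cycles.length).sum = ∑ q : w.Cycles with c.symm q.conjClass = i, q.length := by
      intro i
      change ∑ q ∈ _, _ = _
      refine Finset.sum_congr ?_ fun _ _ => rfl
      ext q
      simp [Equiv.symm_apply_eq]
    simp only [h1]
    rw [Finset.sum_fiberwise]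
    simp only [← Cycles.card_fiber]
    rw [← Finset.card_eq_sum_card_fiberwise (fun x _ => Finset.mem_univ _)]
    simp

end WreathProduct

/-! ### Representations -/

/-- `V^{⊗ι}` as a representation of `G ≀ S_ι`: the pair `(f, σ)` sends `⊗_x v_x` to
`⊗_x f(x) v_{σ⁻¹ x}`. -/
def wreathTensorPower {G : Type*} [Group G] {V : Type*} [AddCommGroup V] [Module ℂ V]
    (ρ : Representation ℂ G V) (ι : Type*) :
    Representation ℂ (WreathProduct G ι) (⨂[ℂ] _ : ι, V) where
  toFun w := PiTensorProduct.map (fun x => ρ (w.left x)) ∘ₗ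
    (PiTensorProduct.reindex ℂ (fun _ : ι => V) w.right).toLinearMap
  map_one' := by
    ext v
    simp
    rfl
  map_mul' w w' := by
    ext v
    simp [PiTensorProduct.reindex_tprod, PiTensorProduct.map_tprod]
    rfl

/-- The external tensor product of representations of the groups `Γ i`, a representation of
their product. -/
def externalTensor {κ : Type*} {Γ : κ → Type*} [∀ i, Group (Γ i)] {W : κ → Type*}
    [∀ i, AddCommGroup (W i)] [∀ i, Module ℂ (W i)] (ρ : ∀ i, Representation ℂ (Γ i) (W i)) :
    Representation ℂ (∀ i, Γ i) (⨂[ℂ] i, W i) where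
  toFun g := PiTensorProduct.map fun i => ρ i (g i)
  map_one' := by
    simp
  map_mul' g h := by
    simp [PiTensorProduct.map_mul]

namespace Multipartition

variable {k N : ℕ}

/-- The subgroup `G_{λ_1} × ⋯ × G_{λ_k}` of `G ≀ S_N`, `G_{λ_i} = G ≀ S_{λ_i}`: the elements whose
permutation part lies in the Young subgroup, i.e. preserves every row of `lam`. -/
def youngSubgroup (G : Type*) [Group G] (lam : Multipartition k N) :
    Subgroup (WreathProduct G (Fin N)) where
  carrier := {w | ∀ x, lam.rowOf (w.right x) = lam.rowOf x}
  one_mem' := fun x => rfl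
  mul_mem' := by
    intro a b ha hb x
    rw [SemidirectProduct.mul_right, Equiv.Perm.mul_apply, ha, hb]
  inv_mem' := by
    intro a ha x
    rw [SemidirectProduct.inv_right]
    have h := ha (a.right⁻¹ x)
    rw [show a.right (a.right⁻¹ x) = x from a.right.apply_symm_apply x] at h
    exact h.symm

theorem componentOf_youngSubgroup {G : Type*} [Group G] (lam : Multipartition k N)
    (w : lam.youngSubgroup G) (x : Fin N) :
    lam.componentOf (w.1.right x) = lam.componentOf x := by
  rw [componentOf, componentOf, w.2 x]

/-- The inclusion of `G_{λ_1} × ⋯ × G_{λ_k}` into `∏_i G ≀ S_{a_i}`, where `a_i = |λ_i|` and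
`S_{a_i}` permutes the positions belonging to `λ_i`. -/
def toComponents (G : Type*) [Group G] (lam : Multipartition k N) :
    lam.youngSubgroup G →* ∀ i : Fin k, WreathProduct G {x : Fin N // lam.componentOf x = i} where
  toFun w i := ⟨fun x => w.1.left x.1, w.1.right.subtypePerm fun x => by
    rw [lam.componentOf_youngSubgroup w]⟩
  map_one' := by
    funext i
    refine SemidirectProduct.ext ?_ ?_
    · rfl
    · ext x; rfl
  map_mul' w w' := by
    funext i
    refine SemidirectProduct.ext ?_ ?_
    · funext x; rfl
    · ext x; rfl

/-- The representation `⊠_i V_i^{⊗ a_i}` of `G_{λ_1} × ⋯ × G_{λ_k}`. -/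
def inducingRep {G : Type*} [Group G] (V : Fin k → FDRep ℂ G) (lam : Multipartition k N) :
    Representation ℂ (lam.youngSubgroup G)
      (⨂[ℂ] i : Fin k, ⨂[ℂ] _ : {x : Fin N // lam.componentOf x = i}, V i) :=
  (externalTensor fun i => wreathTensorPower (V i).ρ {x : Fin N // lam.componentOf x = i}).comp
    (lam.toComponents G)

/-- The permutation module `M^λ` of `G ≀ S_N`. -/
def permutationModule {G : Type*} [Group G] (V : Fin k → FDRep ℂ G) (lam : Multipartition k N) :
    Representation ℂ (WreathProduct G (Fin N))
      (Representation.IndV (lam.youngSubgroup G).subtype (lam.inducingRep V)) :=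
  Representation.ind (lam.youngSubgroup G).subtype (lam.inducingRep V)

end Multipartition

/-- All complex irreducible characters of `G` are integer-valued. -/
def HasIntegerCharacterTable (G : Type*) [Group G] : Prop :=
  ∀ W : FDRep ℂ G, CategoryTheory.Simple W → ∀ g : G, ∃ n : ℤ, W.character g = n

/-- `V` lists the complex irreducible representations of `G`, each exactly once up to
isomorphism. -/
def IsListOfIrreducibles {G : Type*} [Group G] {k : ℕ} (V : Fin k → FDRep ℂ G) : Prop :=
  (∀ i, CategoryTheory.Simple (V i)) ∧
  (∀ i j, Nonempty (V i ≅ V j) → i = j) ∧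
  ∀ W : FDRep ℂ G, CategoryTheory.Simple W → ∃ i, Nonempty (W ≅ V i)

end

/-! An element `w` of cycle type `μ` acts on `M^λ` with character equal to a sum over all
distributions of the cycles of `w` among the rows of `λ` that fill each row exactly; a cycle of
class `C` put in a row of component `i` contributes the factor `χ_i(C)`. Hence the value is a
coefficient, with exponents the row lengths, of the product over cycles of `∑ r, χ_r(C) X_r ^
length`, where `χ_r` is the character attached to row `r` (`character_permutationModule_eq_coeff`).
This polynomial depends only on `μ` and has integer coefficients, because the character table is
integral.

Modulo `p`, Frobenius and Fermat give `(∑ r, a_r X_r ^ m) ^ p = ∑ r, a_r X_r ^ (m * p)`, so trading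
one part `m * p` for `p` parts `m` leaves the polynomial unchanged (`genPoly_eq_of_mash`), and with
it every coefficient.

The character formula combines the induced character (`character_ind`) with the trace on `V^{⊗ι}`,
which is a product over cycles of the character at the cycle product
(`character_wreathTensorPower`). -/

noncomputable section

/-! ### Traces on coinvariants and induced characters -/

namespace Representation

/-- The trace of an endomorphism induced on the coinvariants of a representation of a finite
group. -/
theorem trace_coinvariants_map {K H E : Type*} [Field K] [CharZero K] [Group H] [Fintype H]
    [AddCommGroup E] [Module K E] [Module.Finite K E] (ρ : Representation K H E)
    (f : IntertwiningMap ρ ρ) :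
    LinearMap.trace K _ (Coinvariants.map ρ ρ f) =
      (Fintype.card H : K)⁻¹ * ∑ h, LinearMap.trace K E (ρ h ∘ₗ f.toLinearMap) := by
  have hc : (Fintype.card H : K) ≠ 0 := by simp
  -- Averaging over `H` gives a section of the quotient map. As `s ∘ mk` is the averaging operator,
  -- cyclicity moves the trace from the coinvariants to `E`.
  let s : ρ.Coinvariants →ₗ[K] E := Coinvariants.lift ρ ((Fintype.card H : K)⁻¹ • ∑ h, ρ h) fun x => by
    ext v
    simp only [LinearMap.comp_apply, LinearMap.smul_apply, LinearMap.sum_apply]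
    congr 1
    exact Fintype.sum_equiv (Equiv.mulRight x) _ _ fun h => by simp
  have hs : Coinvariants.mk ρ ∘ₗ s = LinearMap.id := by
    ext v
    simp [s, Finset.card_univ, ← Nat.cast_smul_eq_nsmul K, smul_smul, hc]
  have h1 : Coinvariants.map ρ ρ f = Coinvariants.mk ρ ∘ₗ (f.toLinearMap ∘ₗ s) := by
    rw [← LinearMap.comp_assoc]
    conv_lhs => rw [← LinearMap.comp_id (Coinvariants.map ρ ρ f), ← hs]
    rfl
  have h2 : s ∘ₗ Coinvariants.mk ρ = (Fintype.card H : K)⁻¹ • ∑ h, ρ h := rfl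
  rw [h1, LinearMap.trace_comp_comm', LinearMap.comp_assoc, LinearMap.trace_comp_comm', h2,
    LinearMap.smul_comp, map_smul, smul_eq_mul, ← map_sum (LinearMap.trace K E)]
  congr 2
  ext v
  simp

open Classical in
/-- The character of an induced representation. -/
theorem character_ind {K H Γ W : Type*} [Field K] [CharZero K] [Group H] [Fintype H]
    [Group Γ] [Fintype Γ] [AddCommGroup W] [Module K W] [Module.Finite K W] (φ : H →* Γ)
    (ρ : Representation K H W) (w : Γ) :
    (ind φ ρ).character w =
      (Fintype.card H : K)⁻¹ * ∑ h, ∑ g, if φ h = g * w * g⁻¹ then ρ.character h else 0 := by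
  rw [character, ind_apply, trace_coinvariants_map]
  congr 1
  refine Finset.sum_congr rfl fun h _ => ?_
  -- Here `h` and `w` together permute the basis `Γ` by `x ↦ φ h * x * w⁻¹`, tensored with `ρ h`;
  -- the trace is the number of fixed points times `ρ.character h`.
  have : (Representation.tprod ((leftRegular K Γ).comp φ) ρ) h ∘ₗ
    (MonoidAlgebra.mapDomainLinearMap K K fun x => x * w⁻¹).rTensor W = 
    TensorProduct.map (MonoidAlgebra.mapDomainLinearMap K K fun x => φ h * x * w⁻¹) (ρ h) := by
    ext; simp [mul_assoc]
  refine (congrArg _ this).trans ?_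
  rw [LinearMap.trace_tensorProduct', LinearMap.trace_eq_matrix_trace K (MonoidAlgebra.basis Γ K),
    Matrix.trace, Finset.sum_mul]
  refine Finset.sum_congr rfl fun g _ => ?_
  have hg : φ h * g * w⁻¹ = g ↔ φ h = g * w * g⁻¹ := by
    rw [mul_inv_eq_iff_eq_mul, eq_mul_inv_iff_mul_eq]
  rw [Matrix.diag_apply, LinearMap.toMatrix_apply]
  simp [MonoidAlgebra.basis, Finsupp.single_apply, hg, character]
end Representation

/-! ### Matrix products along the cycles of a permutation -/

/-- Path expansion: `p` lists the `n` interior vertices of a path of `n + 1` steps from `a` to `b`;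
`cons` gives the sources of the steps and `snoc` their targets. -/
theorem Matrix.list_range_prod_apply {R B : Type*} [CommSemiring R] [Fintype B] [DecidableEq B]
    (n : ℕ) (A : ℕ → Matrix B B R) (a b : B) :
    ((List.range (n + 1)).map A).prod a b =
      ∑ p : Fin n → B, ∏ m : Fin (n + 1), A m (Fin.cons (α := fun _ => B) a p m)
        (Fin.snoc (α := fun _ => B) p b m) := by
  induction n generalizing A a with
  | zero => simp [Fin.snoc]
  | succ n ih =>
    rw [List.prod_range_succ', Matrix.mul_apply, ← (Fin.consEquiv fun _ => B).sum_comp,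
      Fintype.sum_prod_type]
    refine Finset.sum_congr rfl fun c _ => ?_
    rw [ih fun m => A (m + 1), Finset.mul_sum]
    refine Finset.sum_congr rfl fun p _ => ?_
    rw [Fin.prod_univ_succ (n := n + 1)]
    have h : Fin.snoc (α := fun _ => B) ((Fin.consEquiv fun _ => B) (c, p)) b =
        Fin.cons (α := fun _ => B) c (Fin.snoc (α := fun _ => B) p b) :=
      (Fin.cons_snoc_eq_snoc_cons ..).symm
    simp only [h, Fin.consEquiv_apply, Fin.cons_zero, Fin.cons_succ, Fin.val_succ, Fin.val_zero]

/-- The trace of a product of matrices as a sum over closed paths. -/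
theorem Matrix.trace_list_range_prod {R B κ : Type*} [CommSemiring R] [Fintype B] [DecidableEq B]
    [Fintype κ] [DecidableEq κ] (n : ℕ) (A : κ → Matrix B B R) (e : Fin (n + 1) ≃ κ) (τ : κ → κ)
    (hτ : ∀ m, τ (e m) = e (finRotate _ m)) (A' : ℕ → Matrix B B R)
    (hA : ∀ m : Fin (n + 1), A' m = A (e m)) :
    Matrix.trace ((List.range (n + 1)).map A').prod = ∑ p : κ → B, ∏ x, A x (p x) (p (τ x)) := by
  rw [← (e.arrowCongr (Equiv.refl B)).sum_comp, ← (Fin.consEquiv fun _ => B).sum_comp,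
    Fintype.sum_prod_type]
  refine Finset.sum_congr rfl fun a _ => ?_
  rw [Matrix.diag_apply, Matrix.list_range_prod_apply]
  refine Finset.sum_congr rfl fun p _ => ?_
  rw [← e.prod_comp]
  refine Finset.prod_congr rfl fun m _ => ?_
  -- The path is closed, so the list of targets is the rotated list of sources.
  rw [hA, hτ, Fin.snoc_eq_cons_rotate]
  simp

theorem Function.minimalPeriod_perm_inv {ι : Type*} (σ : Equiv.Perm ι) (x : ι) :
    Function.minimalPeriod (σ⁻¹ : Equiv.Perm ι) x = Function.minimalPeriod σ x := by
  rw [Function.minimalPeriod_eq_minimalPeriod_iff]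
  intro n
  simp only [Function.IsPeriodicPt, Function.IsFixedPt, Equiv.Perm.iterate_eq_pow, inv_pow]
  rw [Equiv.Perm.inv_eq_iff_eq, eq_comm]

/-- The cycle of a permutation through a point, as a cyclically ordered set. -/
theorem Equiv.Perm.exists_equiv_cycle {ι : Type*} [Finite ι] (σ : Equiv.Perm ι) (x : ι) :
    ∃ (n : ℕ) (e : Fin (n + 1) ≃ {y // σ.SameCycle y x}), Function.minimalPeriod σ x = n + 1 ∧
      (∀ m, (e m : ι) = (σ⁻¹ ^ (m : ℕ)) x) ∧ ∀ m, σ⁻¹ (e m : ι) = e (finRotate _ m) := by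
  obtain ⟨n, hn⟩ : ∃ n, Function.minimalPeriod σ x = n + 1 :=
    Nat.exists_eq_add_one.2 (Function.minimalPeriod_pos_of_mem_periodicPts
      (Function.Injective.mem_periodicPts σ.injective x))
  have hn' := (Function.minimalPeriod_perm_inv σ x).trans hn
  let f : Fin (n + 1) → {y // σ.SameCycle y x} := fun m => ⟨(σ⁻¹ ^ (m : ℕ)) x, m, by simp⟩
  have hf : Function.Bijective f := by
    constructor
    · intro a b hab
      have h : (σ⁻¹ ^ (a : ℕ)) x = (σ⁻¹ ^ (b : ℕ)) x := congrArg Subtype.val hab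
      simp only [← Equiv.Perm.iterate_eq_pow] at h
      exact Fin.ext ((Function.iterate_eq_iterate_iff_of_lt_minimalPeriod
        (a.2.trans_eq hn'.symm) (b.2.trans_eq hn'.symm)).1 h)
    · rintro ⟨y, hy⟩
      obtain ⟨m, hm⟩ := (Equiv.Perm.sameCycle_inv.2 hy.symm).exists_nat_pow_eq
      refine ⟨⟨m % (n + 1), Nat.mod_lt _ n.succ_pos⟩, Subtype.ext ?_⟩
      change (σ⁻¹ ^ (m % (n + 1))) x = y
      rw [← hm, ← hn', ← Equiv.Perm.iterate_eq_pow, ← Equiv.Perm.iterate_eq_pow,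
        Function.iterate_mod_minimalPeriod_eq]
  refine ⟨n, Equiv.ofBijective f hf, hn, fun m => rfl, fun m => ?_⟩
  change σ⁻¹ ((σ⁻¹ ^ (m : ℕ)) x) = (σ⁻¹ ^ (finRotate _ m : ℕ)) x
  rw [← Equiv.Perm.mul_apply, ← pow_succ']
  -- Only the last index wraps around, and there the period brings the point back to `x`.
  refine Fin.lastCases ?_ (fun i => ?_) m
  · rw [finRotate_last, Fin.val_last, ← Equiv.Perm.iterate_eq_pow]
    have h := Function.iterate_minimalPeriod (f := ⇑(σ⁻¹ : Equiv.Perm ι)) (x := x)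
    rwa [hn'] at h
  · rw [finRotate_apply, Fin.coeSucc_eq_succ]
    rfl

open Classical in
instance Equiv.Perm.fintypeCycles {ι : Type*} [Fintype ι] (σ : Equiv.Perm ι) :
    Fintype (Quotient (SameCycle.setoid σ)) :=
  Quotient.fintype _

/-- A sum over colourings of the points moved by a permutation as a product over its cycles. -/
theorem Equiv.Perm.sum_prod_eq_prod_cycles {R B ι : Type*} [CommSemiring R] [Fintype B]
    [DecidableEq B] [Fintype ι] [DecidableEq ι] (σ : Equiv.Perm ι) (A : ι → Matrix B B R) :
    ∑ p : ι → B, ∏ x, A x (p x) (p (σ⁻¹ x)) =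
      ∏ q : Quotient (SameCycle.setoid σ),
        Matrix.trace ((List.range (Function.minimalPeriod σ q.out)).map
          fun m => A ((σ⁻¹ ^ m) q.out)).prod := by
  classical
  have key : ∀ q : Quotient (SameCycle.setoid σ),
      Matrix.trace ((List.range (Function.minimalPeriod σ q.out)).map
          fun m => A ((σ⁻¹ ^ m) q.out)).prod =
      ∑ p : {y // σ.SameCycle y q.out} → B, ∏ x, A x.1 (p x)
        (p ⟨σ⁻¹ x.1, Equiv.Perm.sameCycle_symm_apply_left.2 x.2⟩) := by
    intro q
    obtain ⟨n, e, hn, he, he'⟩ := σ.exists_equiv_cycle q.out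
    rw [hn]
    exact Matrix.trace_list_range_prod n (fun x : {y // σ.SameCycle y q.out} => A x.1) e
      (fun x => ⟨σ⁻¹ x.1, Equiv.Perm.sameCycle_symm_apply_left.2 x.2⟩)
      (fun m => Subtype.ext (he' m)) _ fun m => by rw [he]
  have hq : ∀ (q : Quotient (SameCycle.setoid σ)) (y : ι),
      (Quotient.mk _ y : Quotient (SameCycle.setoid σ)) = q ↔ σ.SameCycle y q.out := fun q y =>
    Quotient.mk_eq_iff_out
  simp only [key]
  -- Colouring every cycle separately amounts to colouring all of `ι`.
  rw [Finset.prod_univ_sum, Fintype.piFinset_univ]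
  refine Fintype.sum_equiv
    { toFun := fun p q y => p y.1
      invFun := fun P x => P (Quotient.mk _ x) ⟨x, (hq _ x).1 rfl⟩
      left_inv := fun p => rfl
      right_inv := fun P => by
        funext q ⟨y, hy⟩
        obtain rfl := (hq q y).2 hy
        rfl } _ _ fun p => ?_
  rw [← Finset.prod_fiberwise Finset.univ
    (fun x => (Quotient.mk _ x : Quotient (SameCycle.setoid σ)))]
  refine Finset.prod_congr rfl fun q _ => ?_
  exact Finset.prod_subtype _ (fun x => by simp [hq]) _

/-! ### Characters of tensor powers -/

namespace PiTensorProduct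

/-- The trace of a tensor product of endomorphisms. -/
theorem trace_map {K ι : Type*} [Field K] [Fintype ι] {M : ι → Type*} [∀ i, AddCommGroup (M i)]
    [∀ i, Module K (M i)] [∀ i, Module.Finite K (M i)] (f : ∀ i, M i →ₗ[K] M i) :
    LinearMap.trace K _ (PiTensorProduct.map f) = ∏ i, LinearMap.trace K _ (f i) := by
  classical
  let b i := Module.finBasis K (M i)
  rw [LinearMap.trace_eq_matrix_trace K (Basis.piTensorProduct b)]
  simp only [fun i => LinearMap.trace_eq_matrix_trace K (b i) (f i), Matrix.trace,
    Matrix.diag_apply, LinearMap.toMatrix_apply]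
  rw [Finset.prod_univ_sum, Fintype.piFinset_univ]
  simp [PiTensorProduct.map_tprod]

end PiTensorProduct

theorem wreathTensorPower_tprod {G : Type*} [Group G] {V : Type*} [AddCommGroup V]
    [Module ℂ V] (ρ : Representation ℂ G V) (ι : Type*) (w : WreathProduct G ι) (v : ι → V) :
    wreathTensorPower ρ ι w (PiTensorProduct.tprod ℂ v) =
      PiTensorProduct.tprod ℂ fun x => ρ (w.left x) (v (w.right⁻¹ x)) := by
  simp [wreathTensorPower, PiTensorProduct.reindex_tprod, PiTensorProduct.map_tprod]

/-- In the tensor basis indexed by colourings `p`, the diagonal entry at `p` is the product over `x`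
of the `(p x, p (σ⁻¹ x))` entries of `ρ (w.left x)`, where `σ = w.right`; the sum over `p` then
factors over cycles. -/
theorem character_wreathTensorPower {G : Type*} [Group G] {V : Type*} [AddCommGroup V]
    [Module ℂ V] [Module.Finite ℂ V] (ρ : Representation ℂ G V) (ι : Type*) [Fintype ι]
    (w : WreathProduct G ι) :
    (wreathTensorPower ρ ι).character w =
      ∏ q : Quotient (Equiv.Perm.SameCycle.setoid w.right), ρ.character (w.cycleProduct q.out) := by
  classical
  let b := Module.finBasis ℂ V
  let A : G →* Matrix _ _ ℂ := MonoidHom.comp (MonoidHomClass.toMonoidHom (LinearMap.toMatrixAlgEquiv b)) ρ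
  have h := w.right.sum_prod_eq_prod_cycles fun x => A (w.left x)
  have hA : ∀ g, (A g).trace = ρ.character g := fun g =>
    (LinearMap.trace_eq_matrix_trace ℂ b _).symm
  simp only [← map_list_prod, hA, ← Function.comp_def A, ← List.map_map] at h
  rw [Representation.character, LinearMap.trace_eq_matrix_trace ℂ (Basis.piTensorProduct fun _ => b)]
  simp only [Matrix.trace, Matrix.diag_apply, LinearMap.toMatrix_apply, Basis.piTensorProduct_apply]
  refine Eq.trans (Finset.sum_congr rfl fun p _ => ?_) h
  rw [wreathTensorPower_tprod, Basis.piTensorProduct_repr_tprod_apply]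
  refine Finset.prod_congr rfl fun x _ => ?_
  exact (LinearMap.toMatrix_apply b b (ρ (w.left x)) _ _).symm

/-! ### Cycle products under conjugation -/

namespace WreathProduct

variable {G : Type*} [Group G]

theorem right_conj_apply {ι : Type*} (g w : WreathProduct G ι) (x : ι) :
    (g * w * g⁻¹).right (g.right x) = g.right (w.right x) := by
  simp

theorem right_conj_inv_pow_apply {ι : Type*} (g w : WreathProduct G ι) (m : ℕ) (x : ι) :
    ((g * w * g⁻¹).right⁻¹ ^ m) (g.right x) = g.right ((w.right⁻¹ ^ m) x) := by
  have h : (g * w * g⁻¹).right⁻¹ = g.right * w.right⁻¹ * g.right⁻¹ := by simp [mul_assoc]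
  rw [h, conj_pow]
  simp

theorem left_conj_apply {ι : Type*} (g w : WreathProduct G ι) (x : ι) :
    (g * w * g⁻¹).left (g.right x) =
      g.left (g.right x) * w.left x * (g.left (g.right (w.right⁻¹ x)))⁻¹ := by
  have h : (g * w * g⁻¹).left (g.right x) = g.left (g.right x) * w.left (g.right⁻¹ (g.right x)) *
      (g.left (g.right⁻¹⁻¹ ((g.right * w.right)⁻¹ (g.right x))))⁻¹ := rfl
  rw [h]
  simp

theorem cycleLength_conj {ι : Type*} (g w : WreathProduct G ι) (x : ι) :
    (g * w * g⁻¹).cycleLength (g.right x) = w.cycleLength x := by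
  have h : Function.Semiconj g.right w.right (g * w * g⁻¹).right := fun x =>
    (right_conj_apply g w x).symm
  exact (Function.minimalPeriod_eq_minimalPeriod_iff.2 fun n =>
    ⟨fun hn => g.right.injective (((h.iterate_right n).eq x).trans hn), fun hn => hn.map h⟩)

/-- Neighbouring factors `(a (m + 1))⁻¹` and `a (m + 1)` cancel. Around a full cycle `a n = a 0`, so
what remains is a conjugation. -/
theorem list_prod_telescope (a b : ℕ → G) (n : ℕ) :
    ((List.range n).map fun m => a m * b m * (a (m + 1))⁻¹).prod =
      a 0 * ((List.range n).map b).prod * (a n)⁻¹ := by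
  induction n with
  | zero => simp
  | succ n ih => rw [List.prod_range_succ, List.prod_range_succ, ih]; group

/-- Cycle products of conjugate elements are conjugate. -/
theorem cycleProduct_conj {ι : Type*} (g w : WreathProduct G ι) (x : ι) :
    (g * w * g⁻¹).cycleProduct (g.right x) =
      g.left (g.right x) * w.cycleProduct x * (g.left (g.right x))⁻¹ := by
  have hx : (w.right⁻¹ ^ w.cycleLength x) x = x := by
    rw [inv_pow, Equiv.Perm.inv_eq_iff_eq, right_pow_cycleLength]
  have h := list_prod_telescope (fun m => g.left (g.right ((w.right⁻¹ ^ m) x)))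
    (fun m => w.left ((w.right⁻¹ ^ m) x)) (w.cycleLength x)
  simp only [hx] at h
  rw [cycleProduct, cycleLength_conj]
  refine Eq.trans ?_ h
  congr 2
  funext m
  rw [right_conj_inv_pow_apply, left_conj_apply, pow_succ', Equiv.Perm.mul_apply]


theorem cycleClass_conj {ι : Type*} (g w : WreathProduct G ι) (x : ι) :
    (g * w * g⁻¹).cycleClass (g.right x) = w.cycleClass x := by
  rw [cycleClass, cycleProduct_conj]
  exact (ConjClasses.mk_eq_mk_iff_isConj.2 (isConj_iff.2 ⟨_, rfl⟩)).symm

/-- A product over the cycles of a conjugate. -/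
theorem prod_cycles_conj {R : Type*} [CommMonoid R] {N : ℕ} (g w : WreathProduct G (Fin N))
    (P : Fin N → R) (hP : ∀ x, P ((g * w * g⁻¹).right x) = P x) :
    ∏ q : (g * w * g⁻¹).Cycles, P q.out = ∏ q : w.Cycles, P (g.right q.out) := by
  have hc : ∀ x y, w.right.SameCycle x y ↔
      (g * w * g⁻¹).right.SameCycle (g.right x) (g.right y) := fun x y => by
    have h : (g * w * g⁻¹).right = g.right * w.right * g.right⁻¹ := by simp
    rw [h, Equiv.Perm.sameCycle_conj]
    simp
  let e : w.Cycles ≃ (g * w * g⁻¹).Cycles := Quotient.congr g.right hc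
  refine (Fintype.prod_equiv e _ _ fun q => ?_).symm
  refine apply_eq_of_sameCycle _ P hP ?_
  have h : e q = Quotient.mk _ (g.right q.out) := by
    conv_lhs => rw [← Quotient.out_eq q]
    rfl
  exact Quotient.eq.1 ((Quotient.out_eq (e q)).trans h).symm

end WreathProduct

/-! ### The character of the inducing representation -/

namespace Multipartition

variable {G : Type*} [Group G] {k N : ℕ}

/-- The value at `x` of the character attached to the row of `x` on the cycle product
through `x`. -/
def cycleValue (V : Fin k → FDRep ℂ G) (lam : Multipartition k N) (w : WreathProduct G (Fin N))
    (x : Fin N) : ℂ :=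
  (V (lam.componentOf x)).character (w.cycleProduct x)

theorem _root_.FDRep.character_eq_of_mk_eq (W : FDRep ℂ G) {a b : G}
    (h : ConjClasses.mk a = ConjClasses.mk b) : W.character a = W.character b := by
  obtain ⟨c, rfl⟩ := isConj_iff.1 (ConjClasses.mk_eq_mk_iff_isConj.1 h)
  exact (W.char_conj _ _).symm

/-- Makes products over cycles independent of the representatives `q.out`. -/
theorem cycleValue_apply (V : Fin k → FDRep ℂ G) (lam : Multipartition k N)
    (w : lam.youngSubgroup G) (x : Fin N) :
    lam.cycleValue V w.1 (w.1.right x) = lam.cycleValue V w.1 x := by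
  rw [cycleValue, cycleValue, componentOf_youngSubgroup]
  exact FDRep.character_eq_of_mk_eq _ (w.1.cycleClass_apply x)

theorem toComponents_right_pow (lam : Multipartition k N) (w : lam.youngSubgroup G) (i : Fin k)
    (m : ℕ) (x : {x : Fin N // lam.componentOf x = i}) :
    (((lam.toComponents G w i).right⁻¹ ^ m) x : Fin N) = (w.1.right⁻¹ ^ m) x := by
  induction m with
  | zero => rfl
  | succ m ih =>
    rw [pow_succ', pow_succ', Equiv.Perm.mul_apply, Equiv.Perm.mul_apply, ← ih]
    rfl

theorem cycleProduct_toComponents (lam : Multipartition k N) (w : lam.youngSubgroup G) (i : Fin k)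
    (x : {x : Fin N // lam.componentOf x = i}) :
    (lam.toComponents G w i).cycleProduct x = w.1.cycleProduct x := by
  have h : (lam.toComponents G w i).cycleLength x = w.1.cycleLength x := by
    have h : Function.Semiconj (Subtype.val : {x // lam.componentOf x = i} → Fin N)
      (lam.toComponents G w i).right w.1.right := fun x => rfl
    exact (Function.minimalPeriod_eq_minimalPeriod_iff.2 fun n =>
      ⟨fun hn => hn.map h, fun hn => Subtype.ext (((h.iterate_right n).eq x).trans hn)⟩)
  rw [WreathProduct.cycleProduct, h]
  simp only [WreathProduct.cycleProduct, ← toComponents_right_pow]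
  rfl

/-- A cycle of an element of the Young subgroup stays inside one component, so the cycles of `w` are
the disjoint union of those of its components, each handled by `character_wreathTensorPower`. -/
theorem character_inducingRep (V : Fin k → FDRep ℂ G) (lam : Multipartition k N)
    (w : lam.youngSubgroup G) :
    (lam.inducingRep V).character w = ∏ q : w.1.Cycles, lam.cycleValue V w.1 q.out := by
  classical
  have h1 : (lam.inducingRep V).character w = ∏ i, ∏ q : Quotient
      (Equiv.Perm.SameCycle.setoid (lam.toComponents G w i).right),
      lam.cycleValue V w.1 q.out.1 := by
    refine (PiTensorProduct.trace_map _).trans (Finset.prod_congr rfl fun i _ => ?_)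
    refine (character_wreathTensorPower _ _ _).trans (Finset.prod_congr rfl fun q _ => ?_)
    rw [cycleProduct_toComponents, cycleValue, q.out.2]
    rfl
  rw [h1, ← Fintype.prod_sigma' fun i
    (q : Quotient (Equiv.Perm.SameCycle.setoid (lam.toComponents G w i).right)) =>
    lam.cycleValue V w.1 q.out.1]
  have hs : ∀ (i : Fin k) (x y : {x : Fin N // lam.componentOf x = i}),
      (lam.toComponents G w i).right.SameCycle x y ↔ w.1.right.SameCycle x y := fun i x y =>
    Equiv.Perm.sameCycle_subtypePerm (h := fun x => by rw [lam.componentOf_youngSubgroup w])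
  let Ψ : (Σ i, Quotient (Equiv.Perm.SameCycle.setoid (lam.toComponents G w i).right)) →
      w.1.Cycles := fun s => Quotient.map Subtype.val (fun x y h => (hs s.1 x y).1 h) s.2
  have hΨ : ∀ s, Ψ s = Quotient.mk _ s.2.out.1 := by
    rintro ⟨i, q⟩
    conv_lhs => rw [← Quotient.out_eq q]
    rfl
  have hbij : Function.Bijective Ψ := by
    constructor
    · rintro ⟨i, q⟩ ⟨j, r⟩ h
      induction q using Quotient.inductionOn with | h x => ?_
      induction r using Quotient.inductionOn with | h y => ?_
      obtain ⟨x, rfl⟩ := x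
      obtain ⟨y, hy⟩ := y
      have hxy : w.1.right.SameCycle x y := Quotient.eq.1 h
      have hc := WreathProduct.apply_eq_of_sameCycle w.1.right lam.componentOf
        (lam.componentOf_youngSubgroup w) hxy
      obtain rfl : lam.componentOf x = j := hc.trans hy
      congr 1
      exact Quotient.sound ((hs _ _ _).2 hxy)
    · intro q
      exact ⟨⟨lam.componentOf q.out, Quotient.mk _ ⟨q.out, rfl⟩⟩, Quotient.out_eq q⟩
  refine Fintype.prod_bijective Ψ hbij _ _ fun s => ?_
  -- The representatives chosen on the two sides may differ, but they lie on the same cycle.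
  refine WreathProduct.apply_eq_of_sameCycle _ _ (lam.cycleValue_apply V w) ?_
  exact Quotient.eq.1 ((hΨ s).symm.trans (Quotient.out_eq _).symm)

end Multipartition

/-! ### The character of the permutation module -/

instance SemidirectProduct.instFinite {N G : Type*} [Group N] [Group G] [Finite N] [Finite G]
    (φ : G →* MulAut N) : Finite (N ⋊[φ] G) :=
  Finite.of_equiv _ SemidirectProduct.equivProd.symm

/-- Two functions on a finite set differ by a permutation of the domain iff their fibres have
the same sizes. -/
theorem exists_perm_comp_eq_iff {α β : Type*} [Fintype α] [DecidableEq β] (f g : α → β) :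
    (∃ σ : Equiv.Perm α, f ∘ σ = g) ↔
      ∀ b, (Finset.univ.filter fun a => g a = b).card =
        (Finset.univ.filter fun a => f a = b).card := by
  constructor
  · rintro ⟨σ, rfl⟩ b
    exact Finset.card_bij (fun a _ => σ a) (by simp) (by simp)
      fun a ha => ⟨σ.symm a, by simpa using ha, by simp⟩
  · intro h
    have e : ∀ b, {a // g a = b} ≃ {a // f a = b} := fun b =>
      Fintype.equivOfCardEq (by rw [Fintype.card_subtype, Fintype.card_subtype, h b])
    exact ⟨Equiv.ofFiberEquiv e, funext fun a => Equiv.ofFiberEquiv_map e a⟩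

theorem WreathProduct.card_filter_comp_mk {G β : Type*} [Group G] [DecidableEq β] {N : ℕ}
    (w : WreathProduct G (Fin N)) (F : w.Cycles → β) (b : β) :
    (Finset.univ.filter fun x : Fin N => F (Quotient.mk _ x) = b).card =
      ∑ q with F q = b, q.length := by
  classical
  rw [Finset.card_eq_sum_card_fiberwise (f := fun x : Fin N => (Quotient.mk _ x : w.Cycles))
    (t := Finset.univ.filter fun q => F q = b) (fun x hx => by simpa using hx)]
  refine Finset.sum_congr rfl fun q hq => ?_
  rw [← Cycles.card_fiber q, Finset.filter_filter]
  congr 1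
  ext x
  simp only [Finset.mem_filter, Finset.mem_univ, true_and] at hq ⊢
  exact ⟨And.right, fun h => ⟨h ▸ hq, h⟩⟩

namespace Multipartition

variable {G : Type*} [Group G] {k N : ℕ}

/-- The length of a row of `lam`, as the number of positions belonging to it. -/
def rowLength (lam : Multipartition k N) (r : Fin lam.rows.length) : ℕ :=
  (Finset.univ.filter fun x => lam.rowOf x = r).card

-- The set counted is empty or a coset of the Young subgroup; it is nonempty exactly when the fibres
-- of `F` have the sizes of the rows.
open Classical in
theorem card_filter_rowOf_comp (lam : Multipartition k N) [Fintype (WreathProduct G (Fin N))]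
    [Fintype (lam.youngSubgroup G)] (F : Fin N → Fin lam.rows.length) :
    (Finset.univ.filter fun g : WreathProduct G (Fin N) => lam.rowOf ∘ g.right = F).card =
      if ∀ r, (Finset.univ.filter fun x => F x = r).card = lam.rowLength r
        then Fintype.card (lam.youngSubgroup G) else 0 := by
  split_ifs with h
  · obtain ⟨σ, hσ⟩ := (exists_perm_comp_eq_iff lam.rowOf F).2 h
    rw [← Finset.card_univ]
    refine (Finset.card_bij (fun (a : lam.youngSubgroup G) _ => a.1 * SemidirectProduct.inr σ)
      (fun a _ => ?_) (fun a _ b _ hab => Subtype.ext (mul_right_cancel hab)) fun g hg => ?_).symm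
    · simp only [Finset.mem_filter, Finset.mem_univ, true_and]
      rw [← hσ]
      funext x
      exact a.2 (σ x)
    · have hg : lam.rowOf ∘ g.right = F := by simpa using hg
      refine ⟨⟨g * (SemidirectProduct.inr σ)⁻¹, fun x => ?_⟩, Finset.mem_univ _, by simp⟩
      have h1 := congrFun (hg.trans hσ.symm) (σ⁻¹ x)
      simpa using h1
  · rw [Finset.card_eq_zero, Finset.filter_eq_empty_iff]
    exact fun g _ hg => h ((exists_perm_comp_eq_iff lam.rowOf F).1 ⟨g.right, hg⟩)

open Classical in
/-- The character of `lam.permutationModule V` at `w` is a sum over the ways to distribute the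
cycles of `w` among the rows of `lam`. -/
theorem character_permutationModule [Finite G] (V : Fin k → FDRep ℂ G) (lam : Multipartition k N)
    (w : WreathProduct G (Fin N)) :
    (lam.permutationModule V).character w =
      ∑ F : w.Cycles → Fin lam.rows.length,
        if ∀ r, ∑ q with F q = r, q.length = lam.rowLength r then
          ∏ q : w.Cycles, (V (lam.rows.get (F q)).1).character (w.cycleProduct q.out) else 0 := by
  classical
  have := Fintype.ofFinite (WreathProduct G (Fin N))
  have := Fintype.ofFinite (lam.youngSubgroup G)
  -- The contribution of `g` to the induced character depends only on `F = lam.rowOf ∘ g.right`, and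
  -- vanishes unless `F` is constant on the cycles of `w`.
  let T : (Fin N → Fin lam.rows.length) → ℂ := fun F =>
    if ∀ x, F (w.right x) = F x then
      ∏ q : w.Cycles, (V (lam.rows.get (F q.out)).1).character (w.cycleProduct q.out) else 0
  have h1 : ∀ g : WreathProduct G (Fin N),
      (∑ h : lam.youngSubgroup G,
        if (lam.youngSubgroup G).subtype h = g * w * g⁻¹ then (lam.inducingRep V).character h
          else 0) = T (lam.rowOf ∘ g.right) := by
    intro g
    have hmem : g * w * g⁻¹ ∈ lam.youngSubgroup G ↔
        ∀ x, (lam.rowOf ∘ g.right) (w.right x) = (lam.rowOf ∘ g.right) x := by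
      change (∀ x, lam.rowOf ((g * w * g⁻¹).right x) = lam.rowOf x) ↔ _
      rw [← g.right.forall_congr_right]
      simp only [WreathProduct.right_conj_apply, Function.comp_apply]
    by_cases hg : g * w * g⁻¹ ∈ lam.youngSubgroup G
    · refine (Finset.sum_eq_single (⟨g * w * g⁻¹, hg⟩ : lam.youngSubgroup G) (fun b _ hb =>
        if_neg fun h => hb (Subtype.ext h)) (fun h => absurd (Finset.mem_univ _) h)).trans ?_
      rw [if_pos rfl, character_inducingRep, WreathProduct.prod_cycles_conj g w _
        (lam.cycleValue_apply V ⟨g * w * g⁻¹, hg⟩)]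
      refine Eq.trans ?_ (if_pos (hmem.1 hg)).symm
      refine Finset.prod_congr rfl fun q _ => ?_
      exact FDRep.character_eq_of_mk_eq _ (WreathProduct.cycleClass_conj g w q.out)
    · refine Eq.trans (Finset.sum_eq_zero fun h _ => if_neg fun h' => hg ?_)
        (if_neg (mt hmem.2 hg)).symm
      exact h' ▸ h.2
  have hc : (Fintype.card (lam.youngSubgroup G) : ℂ) ≠ 0 := by simp
  rw [permutationModule, Representation.character_ind, Finset.sum_comm]
  refine (congrArg _ (Finset.sum_congr rfl fun g _ =>
    (Finset.sum_congr rfl fun h _ => by congr).trans (h1 g))).trans ?_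
  rw [← Finset.sum_fiberwise Finset.univ
    (fun g : WreathProduct G (Fin N) => lam.rowOf ∘ g.right)]
  have h2 : ∀ F : Fin N → Fin lam.rows.length,
      ∑ g : WreathProduct G (Fin N) with lam.rowOf ∘ g.right = F, T (lam.rowOf ∘ g.right) =
        Fintype.card (lam.youngSubgroup G) *
          if ∀ r, (Finset.univ.filter fun x => F x = r).card = lam.rowLength r then T F else 0 := by
    intro F
    rw [Finset.sum_congr rfl fun g hg => by rw [(Finset.mem_filter.1 hg).2], Finset.sum_const,
      card_filter_rowOf_comp, nsmul_eq_mul]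
    split_ifs <;> simp
  simp only [h2]
  rw [← Finset.mul_sum, inv_mul_cancel_left₀ hc]
  -- Functions constant on cycles are those factoring through `w.Cycles`; all others contribute
  -- zero.
  refine (Fintype.sum_of_injective
    (fun (F : w.Cycles → Fin lam.rows.length) x => F (Quotient.mk _ x)) ?_ _ _ ?_ ?_).symm
  · intro F F' h
    funext q
    induction q using Quotient.inductionOn with | h x => exact congrFun h x
  · intro F hF
    have : ¬ ∀ x, F (w.right x) = F x := fun h => hF
      ⟨Quotient.lift F fun _ _ h' => WreathProduct.apply_eq_of_sameCycle w.right F h h', rfl⟩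
    simp [T, this]
  · intro F
    have hinv : ∀ x, F (Quotient.mk _ (w.right x)) = F (Quotient.mk _ x) := fun x =>
      congrArg F (Quotient.sound (Equiv.Perm.sameCycle_apply_left.2 (Equiv.Perm.SameCycle.refl _ _)))
    simp only [WreathProduct.card_filter_comp_mk, T, if_pos hinv, Quotient.out_eq]

end Multipartition

/-! ### Generating polynomials and Frobenius -/

theorem MvPolynomial.coeff_prod_sum_C_mul_X_pow {S κ Q : Type*} [CommSemiring S] [Fintype κ]
    [DecidableEq κ] [Fintype Q] [DecidableEq Q] (a : Q → κ → S) (l : Q → ℕ) (d : κ →₀ ℕ) :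
    coeff d (∏ q, ∑ r, C (a q r) * X r ^ l q) =
      ∑ F : Q → κ, if ∀ r, ∑ q with F q = r, l q = d r then ∏ q, a q (F q) else 0 := by
  classical
  rw [Finset.prod_univ_sum, Fintype.piFinset_univ, coeff_sum]
  refine Finset.sum_congr rfl fun F _ => ?_
  have h : ∏ q, C (a q (F q)) * X (F q) ^ l q =
      monomial (∑ q, Finsupp.single (F q) (l q)) (∏ q, a q (F q)) := by
    rw [monomial_sum_index, Finset.prod_mul_distrib, map_prod]
    simp only [X_pow_eq_monomial]
  rw [h, coeff_monomial]
  refine if_congr ?_ rfl rfl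
  rw [Finsupp.ext_iff]
  refine forall_congr' fun r => ?_
  rw [Finsupp.finsetSum_apply, Finset.sum_filter]
  simp only [Finsupp.single_apply]

open MvPolynomial in
/-- The generating function whose coefficients are the character values of permutation modules at
an element of cycle type `μ`; `a r i` is the value at the `i`-th class of the character attached
to the row `r`. -/
def Multipartition.genPoly {k N : ℕ} {κ S : Type*} [Fintype κ] [CommSemiring S]
    (a : κ → Fin k → S) (μ : Multipartition k N) : MvPolynomial κ S :=
  ∏ i, ((μ.parts i).map fun m => ∑ r, C (a r i) * X r ^ m).prod

namespace Multipartition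

variable {k N : ℕ} {κ : Type*} [Fintype κ]

theorem map_genPoly {S S' : Type*} [CommSemiring S] [CommSemiring S'] (f : S →+* S')
    (a : κ → Fin k → S) (μ : Multipartition k N) :
    MvPolynomial.map f (μ.genPoly a) = μ.genPoly fun r i => f (a r i) := by
  simp [genPoly, map_prod, map_multiset_prod]

/-- The `p`-th power of a sum is the sum of `p`-th powers in characteristic `p`, and the
coefficients satisfy `a ^ p = a` because they lie in the prime field. -/
theorem genPoly_eq_of_mash {p : ℕ} [Fact p.Prime] (a : κ → Fin k → ZMod p)
    {μ ν : Multipartition k N} (h : Mash p μ ν) : μ.genPoly a = ν.genPoly a := by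
  obtain ⟨j, m, ξ, hne, hμ, hν⟩ := h
  refine Finset.prod_congr rfl fun i _ => ?_
  by_cases hi : i = j
  · subst hi
    rw [hμ, hν, Multiset.map_cons, Multiset.prod_cons, Multiset.map_add, Multiset.prod_add,
      Multiset.map_replicate, Multiset.prod_replicate, sum_pow_char]
    congr 1
    refine Finset.sum_congr rfl fun r _ => ?_
    rw [mul_pow, ← map_pow, ZMod.pow_card, pow_mul]
  · rw [hne i hi]

theorem genPoly_eq_of_mashEquiv {p : ℕ} [Fact p.Prime] (a : κ → Fin k → ZMod p)
    {μ ν : Multipartition k N} (h : MashEquiv p μ ν) : μ.genPoly a = ν.genPoly a := by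
  induction h with
  | rel _ _ h => exact genPoly_eq_of_mash a h
  | refl _ => rfl
  | symm _ _ _ ih => exact ih.symm
  | trans _ _ _ _ _ ih₁ ih₂ => exact ih₁.trans ih₂

open MvPolynomial in
theorem genPoly_cycleType {G S : Type*} [Group G] [CommSemiring S] (c : Fin k ≃ ConjClasses G)
    (a : κ → Fin k → S) (w : WreathProduct G (Fin N)) :
    (w.cycleType c).genPoly a =
      ∏ q : w.Cycles, ∑ r, C (a r (c.symm q.conjClass)) * X r ^ q.length := by
  classical
  rw [← Finset.prod_fiberwise Finset.univ fun q : w.Cycles => c.symm q.conjClass]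
  refine Finset.prod_congr rfl fun i _ => ?_
  simp only [WreathProduct.cycleType, Multiset.map_map]
  refine Finset.prod_congr ?_ fun q hq => ?_
  · ext q
    simp [Equiv.symm_apply_eq]
  · rw [← (Finset.mem_filter.1 hq).2]
    rfl

/-- The character values of permutation modules as coefficients. -/
theorem character_permutationModule_eq_coeff {G : Type*} [Group G] [Finite G]
    (c : Fin k ≃ ConjClasses G) (V : Fin k → FDRep ℂ G) (n : Fin k → Fin k → ℤ)
    (hn : ∀ i g, (V i).character g = n i (c.symm (ConjClasses.mk g)))
    (lam : Multipartition k N) (w : WreathProduct G (Fin N)) :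
    (lam.permutationModule V).character w =
      (MvPolynomial.coeff (Finsupp.equivFunOnFinite.symm lam.rowLength)
        ((w.cycleType c).genPoly fun r => n (lam.rows.get r).1) : ℤ) := by
  classical
  have h : ∀ q : w.Cycles, ConjClasses.mk (w.cycleProduct q.out) = q.conjClass := fun q => by
    conv_rhs => rw [← Quotient.out_eq q]
    rfl
  rw [character_permutationModule, genPoly_cycleType, MvPolynomial.coeff_prod_sum_C_mul_X_pow,
    Int.cast_sum]
  refine Finset.sum_congr rfl fun F _ => ?_
  simp only [hn, h, Finsupp.equivFunOnFinite_symm_apply_apply]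
  split_ifs <;> simp

end Multipartition

end

/-! ### The congruence -/

theorem mainTheorem4 {G : Type*} [Group G] [Finite G] (hG : HasIntegerCharacterTable G)
    {k : ℕ} (c : Fin k ≃ ConjClasses G) (V : Fin k → FDRep ℂ G) (hV : IsListOfIrreducibles V)
    {p : ℕ} (hp : p.Prime) {N : ℕ} (μ ν : Multipartition k N) (hμν : μ.MashEquiv p ν)
    (lam : Multipartition k N) (x y : WreathProduct G (Fin N))
    (hx : x.cycleType c = μ) (hy : y.cycleType c = ν) :
    ∃ a b : ℤ, (lam.permutationModule V).character x = a ∧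
      (lam.permutationModule V).character y = b ∧ a ≡ b [ZMOD p] := by
  have : Fact p.Prime := ⟨hp⟩
  -- One integer per character and class, chosen uniformly over the class, gives an integral
  -- coefficient table.
  have hex : ∀ i j, ∃ n : ℤ, ∀ g, ConjClasses.mk g = c j → (V i).character g = n := by
    intro i j
    obtain ⟨g, hg⟩ := (c j).exists_rep
    obtain ⟨n, hn⟩ := hG (V i) (hV.1 i) g
    exact ⟨n, fun g' hg' => (FDRep.character_eq_of_mk_eq _ (hg'.trans hg.symm)).trans hn⟩
  choose n hn using hex
  have hn' : ∀ i g, (V i).character g = n i (c.symm (ConjClasses.mk g)) := fun i g =>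
    hn i _ g (c.apply_symm_apply _).symm
  refine ⟨_, _, lam.character_permutationModule_eq_coeff c V n hn' x,
    lam.character_permutationModule_eq_coeff c V n hn' y, ?_⟩
  rw [← ZMod.intCast_eq_intCast_iff, hx, hy]
  have h := Multipartition.genPoly_eq_of_mashEquiv
    (fun (r : Fin lam.rows.length) i => Int.castRingHom (ZMod p) (n (lam.rows.get r).1 i)) hμν
  -- Both polynomials over `ZMod p` are reductions of the integral ones, so equality of their
  -- coefficients is the congruence.
  rw [← Multipartition.map_genPoly, ← Multipartition.map_genPoly] at h
  have h' := congrArg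
    (MvPolynomial.coeff (Finsupp.equivFunOnFinite.symm lam.rowLength)) h
  rwa [MvPolynomial.coeff_map, MvPolynomial.coeff_map] at h'
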